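/- For a string $x\in\{-1,1\}^n$ and $0<\delta<1$, the deletion channel deletes each coordinate of $x$ independently with probability $\delta$; the surviving coordinates, in order, form a random trace of $x$. The mean trace $\mu_\delta(x)\in[-1,1]^n$ is the expectation of a random trace padded with zeros to length $n$. A mean-based trace reconstruction algorithm of cost $T$ (for length $n$ and deletion rate $\delta$), where $T\ge 1$ is an integer that it specifies in advance, is given an arbitrary vector $\widehat\mu\in[-1,1]^n$ with $\|\widehat\mu-\mu_\delta(x)\|_1\le 1/T$, where $x$ is the unknown source string; from $\widehat\mu$ alone, using arbitrary and possibly randomized computation, it must output $x$ with probability at least $99/100$, for every $x\in\{-1,1\}^n$ and every such $\widehat\mu$. The cost $T$ measures the number of traces used. Theorem. For every constant $0<\delta<1$ there are $c>0$ and $n_0$, depending only on $\delta$, such that for all $n\ge n_0$: 1. every mean-based trace reconstruction algorithm for length $n$ and deletion rate $\delta$ has cost $T\ge \exp(c\,n^{1/3})$; 2. there are distinct strings $x,x'\in\{-1,1\}^n$ with $\|\mu_\delta(x)-\mu_\delta(x')\|_1\le\exp(-c\,n^{1/3})$. -/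

import Mathlib

namespace TraceReconstruction

/-- Source strings in `{-1, 1} ^ n`, indexed from `0`; the units of `ℤ` are exactly `1` and `-1`. -/
abbrev SourceString (n : ℕ) : Type := Fin n → ℤˣ

/-- The trace of `x` in which exactly the positions in `S` are retained: the retained bits,
in their original order. -/
def traceOf {n : ℕ} (x : SourceString n) (S : Finset (Fin n)) : List ℤˣ :=
  ((List.finRange n).filter (fun i => decide (i ∈ S))).map x

/-- The probability that the set of retained positions is exactly `S`, when each of the `n`
positions is independently deleted with probability `δ`. -/
def retainProb (δ : ℝ) {n : ℕ} (S : Finset (Fin n)) : ℝ :=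
  ∏ i : Fin n, if i ∈ S then 1 - δ else δ

/-- The entry at position `j` (counted from `0`) of the trace `y` padded with zeros. -/
def paddedEntry (y : List ℤˣ) (j : ℕ) : ℝ :=
  (y.map (fun u : ℤˣ => ((u : ℤ) : ℝ))).getD j 0

/-- The mean trace of `x` under the deletion channel with deletion probability `δ`: the
expectation of a random trace of `x` padded with zeros to length `n`. -/
def meanTrace (δ : ℝ) {n : ℕ} (x : SourceString n) : Fin n → ℝ := fun j =>
  ∑ S : Finset (Fin n), retainProb δ S * paddedEntry (traceOf x S) j

/-- The `ℓ₁` distance of two vectors. -/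
def l1Dist {n : ℕ} (u v : Fin n → ℝ) : ℝ := ∑ j : Fin n, |u j - v j|

/-- An algorithm in the mean-based trace reconstruction model, for source strings of length `n`.
It first specifies its cost, a positive integer `T`; then it is given an estimate of the mean
trace, and from this estimate alone it produces its (possibly randomized) output. -/
structure MeanBasedAlgorithm (n : ℕ) where
  /-- the cost parameter `T` -/
  cost : ℕ
  cost_pos : 0 < cost
  /-- the postprocessing: the distribution of the output, given the estimate -/
  output : (Fin n → ℝ) → PMF (SourceString n)

/-- `v` is an estimate that an algorithm of cost `T` may be given when the source string is `x`:
a vector in `[-1, 1] ^ n` within `ℓ₁` distance `1 / T` of the mean trace of `x`. -/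
def IsEstimate (δ : ℝ) {n : ℕ} (T : ℕ) (x : SourceString n) (v : Fin n → ℝ) : Prop :=
  (∀ j, v j ∈ Set.Icc (-1 : ℝ) 1) ∧ l1Dist v (meanTrace δ x) ≤ 1 / (T : ℝ)

/-- The algorithm solves trace reconstruction at deletion probability `δ`: for every source
string and every admissible estimate of its mean trace, it outputs the source string with
probability at least `99 / 100`. -/
def MeanBasedAlgorithm.Reconstructs {n : ℕ} (A : MeanBasedAlgorithm n) (δ : ℝ) : Prop :=
  ∀ (x : SourceString n) (v : Fin n → ℝ), IsEstimate δ A.cost x v →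
    (99 / 100 : ENNReal) ≤ A.output v x

end TraceReconstruction

/-!
The difference of the mean traces of `x` and `x'` has generating polynomial
`(1 - δ) * A (δ + (1 - δ) w)` in `w`, where `A z = ∑ i, (x i - x' i) z ^ i`
(`sum_meanTrace_mul_pow`). Its coefficients are at most its maximum on the unit circle, so the
`ℓ₁` distance of the mean traces is at most `n` times the maximum of `|A|` on the circle with
centre `δ` and radius `1 - δ` (`l1Dist_meanTrace_le`). It remains to find `A ≠ 0` with
coefficients in `{-2, 0, 2}` that is exponentially small in `t = ⌊n ^ (1 / 3)⌋` on this circle.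

Take `A z = 2 z ^ s B z`, with `B` a difference of two polynomials with coefficients in `{0, 1}` and
degree below `m = 64 t ^ 2`, and `s = n - m ≥ n / 2`. A point of the circle at distance at least
`1 / (64 t)` from `1` has modulus at most `1 - Ω (t ^ (-2))`, since the circle is tangent to the unit
circle at `1`; there the factor `z ^ s` is `exp (-Ω (t))` (`norm_affine_circle_le_exp`). On the disc
of radius `a = 1 / (64 t)` about `1`, all `z ^ j` with `j < m` agree with their Taylor polynomials of
order `8 t` up to `exp (-Ω (t))`, because `m * a = t`. So there are only `8 t` Taylor coefficients to
control, each to precision `3 ^ (-t)`, and the pigeonhole principle applied to the `2 ^ m`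
polynomials yields `B` (`exists_ne_taylor_coeff_close`, `exists_ne_sum_pow_close`).

The bound on the cost follows: if `1 / T` were at least the distance of the two mean traces, the
mean trace of `x` would be an admissible estimate for both strings.
-/

namespace TraceReconstruction

open Finset

/-! ### The generating polynomial of the mean trace -/

lemma sum_getD_map_mul_pow {ι : Type*} [LinearOrder ι] (f : ι → ℝ) (w : ℂ) (l : List ι)
    (hl : l.Pairwise (· < ·)) (N : ℕ) (hN : l.length ≤ N) :
    ∑ j ∈ range N, (((l.map f).getD j 0 : ℝ) : ℂ) * w ^ j =
      ∑ i ∈ l.toFinset, (f i : ℂ) * w ^ #{k ∈ l.toFinset | k < i} := by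
  induction l generalizing N with
  | nil => simp
  | cons a l ih =>
    obtain ⟨ha, hl⟩ := List.pairwise_cons.1 hl
    obtain ⟨N, rfl⟩ : ∃ M, N = M + 1 := ⟨N - 1, by simp at hN; omega⟩
    have hN' : l.length ≤ N := by simpa using hN
    have hal : a ∉ l.toFinset := fun h => lt_irrefl a (ha a (by simpa using h))
    rw [sum_range_succ', List.toFinset_cons, sum_insert hal]
    have h0 : #{k ∈ insert a l.toFinset | k < a} = 0 := by
      rw [card_eq_zero, filter_eq_empty_iff]
      intro k hk
      rcases mem_insert.1 hk with rfl | hk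
      · exact lt_irrefl _
      · exact (ha k (by simpa using hk)).not_gt
    have h1 : ∀ i ∈ l.toFinset,
        #{k ∈ insert a l.toFinset | k < i} = #{k ∈ l.toFinset | k < i} + 1 := by
      intro i hi
      rw [filter_insert, if_pos (ha i (by simpa using hi)), card_insert_of_notMem]
      simp [hal]
    have h2 : ∑ i ∈ l.toFinset, (f i : ℂ) * w ^ #{k ∈ insert a l.toFinset | k < i} =
        (∑ j ∈ range N, (((l.map f).getD j 0 : ℝ) : ℂ) * w ^ j) * w := by
      rw [ih hl N hN', sum_mul]
      exact sum_congr rfl fun i hi => by rw [h1 i hi, pow_succ, mul_assoc]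
    rw [h0, h2, sum_mul, add_comm]
    simp [pow_succ, mul_assoc]

lemma sum_paddedEntry_traceOf_mul_pow {n : ℕ} (x : SourceString n) (S : Finset (Fin n)) (w : ℂ) :
    ∑ j : Fin n, (paddedEntry (traceOf x S) j : ℂ) * w ^ (j : ℕ) =
      ∑ i ∈ S, ((x i : ℤ) : ℂ) * w ^ #{k ∈ S | k < i} := by
  have hS : ((List.finRange n).filter (fun i => decide (i ∈ S))).toFinset = S := by
    ext i; simp
  have h := sum_getD_map_mul_pow (fun i : Fin n => ((x i : ℤ) : ℝ)) w
    ((List.finRange n).filter (fun i => decide (i ∈ S)))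
    ((List.pairwise_lt_finRange n).filter _) n
    ((List.length_filter_le _ _).trans (by simp))
  rw [hS, ← Fin.sum_univ_eq_sum_range
    (fun j => (((List.map (fun i : Fin n => ((x i : ℤ) : ℝ))
      ((List.finRange n).filter (fun i => decide (i ∈ S)))).getD j 0 : ℝ) : ℂ) * w ^ j)] at h
  simpa [paddedEntry, traceOf, Function.comp_def] using h

lemma retainProb_eq (δ : ℝ) {n : ℕ} (S : Finset (Fin n)) :
    retainProb δ S = (∏ _k ∈ S, (1 - δ)) * ∏ _k ∈ Sᶜ, δ := by
  rw [retainProb, prod_ite]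
  congr 2 <;> ext <;> simp

lemma sum_retainProb (δ : ℝ) (n : ℕ) : ∑ S : Finset (Fin n), retainProb δ S = 1 := by
  simp_rw [retainProb_eq]
  rw [← Fintype.prod_add]
  simp

/-- Jointly over the retained sets containing `i`, the number of retained positions before `i`
is binomial, whence its generating function is a power of that of a single position. -/
lemma sum_retainProb_mul_pow_card (δ : ℝ) {n : ℕ} (i : Fin n) (w : ℂ) :
    ∑ S : Finset (Fin n), (if i ∈ S then (retainProb δ S : ℂ) * w ^ #{k ∈ S | k < i} else 0) =
      (1 - δ) * (δ + (1 - δ) * w) ^ (i : ℕ) := by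
  set f : Fin n → ℂ := fun k => (1 - δ) * if k < i then w else 1
  set g : Fin n → ℂ := fun k => if k = i then 0 else δ
  have hterm : ∀ S : Finset (Fin n),
      (if i ∈ S then (retainProb δ S : ℂ) * w ^ #{k ∈ S | k < i} else 0) =
        (∏ k ∈ S, f k) * ∏ k ∈ Sᶜ, g k := by
    intro S
    split_ifs with hi
    · have hg : ∏ k ∈ Sᶜ, g k = ∏ k ∈ Sᶜ, (δ : ℂ) := prod_congr rfl fun k hk => by
        rw [mem_compl] at hk
        refine if_neg ?_
        rintro rfl
        exact hk hi
      rw [hg, prod_mul_distrib, prod_ite, retainProb_eq]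
      simp
      ring
    · rw [prod_eq_zero (i := i) (mem_compl.2 hi) (by simp [g]), mul_zero]
  rw [sum_congr rfl fun S _ => hterm S, ← Fintype.prod_add]
  have hfg : ∀ k, f k + g k = (if k < i then (δ + (1 - δ) * w) else 1) *
      if k = i then (1 - δ : ℂ) else 1 := by
    intro k
    rcases lt_trichotomy k i with h | h | h
    · simp [f, g, h, h.ne]; ring
    · simp [f, g, h]
    · simp [f, g, h.not_gt, h.ne']
  rw [prod_congr rfl fun k _ => hfg k, prod_mul_distrib, prod_ite, prod_ite_eq']
  simp [mul_comm, filter_gt_eq_Iio]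

/-- The generating polynomial of the mean trace is, up to the factor `1 - δ`, that of the source
string composed with the affine map `w ↦ δ + (1 - δ) w`. -/
lemma sum_meanTrace_mul_pow (δ : ℝ) {n : ℕ} (x : SourceString n) (w : ℂ) :
    ∑ j : Fin n, (meanTrace δ x j : ℂ) * w ^ (j : ℕ) =
      (1 - δ) * ∑ i : Fin n, ((x i : ℤ) : ℂ) * (δ + (1 - δ) * w) ^ (i : ℕ) := by
  calc ∑ j : Fin n, (meanTrace δ x j : ℂ) * w ^ (j : ℕ)
      = ∑ S : Finset (Fin n), (retainProb δ S : ℂ) *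
          ∑ j : Fin n, (paddedEntry (traceOf x S) j : ℂ) * w ^ (j : ℕ) := by
        simp_rw [meanTrace, Complex.ofReal_sum, Complex.ofReal_mul, sum_mul, mul_sum, mul_assoc]
        exact sum_comm
    _ = ∑ S : Finset (Fin n), ∑ i : Fin n, ((x i : ℤ) : ℂ) *
          if i ∈ S then (retainProb δ S : ℂ) * w ^ #{k ∈ S | k < i} else 0 := by
        refine sum_congr rfl fun S _ => ?_
        rw [sum_paddedEntry_traceOf_mul_pow, mul_sum]
        simp_rw [mul_ite, mul_zero]
        rw [sum_ite_mem, univ_inter]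
        exact sum_congr rfl fun i _ => by ring
    _ = _ := by
        rw [sum_comm, mul_sum]
        refine sum_congr rfl fun i _ => ?_
        rw [← mul_sum, sum_retainProb_mul_pow_card]
        ring

/-! ### Confusable strings force a large cost -/

lemma abs_paddedEntry_le_one (y : List ℤˣ) (j : ℕ) : |paddedEntry y j| ≤ 1 := by
  unfold paddedEntry
  rw [List.getD_eq_getElem?_getD, List.getElem?_map]
  cases y[j]? with
  | none => simp
  | some u => rcases Int.units_eq_one_or u with rfl | rfl <;> simp

lemma abs_meanTrace_le_one {δ : ℝ} (h0 : 0 ≤ δ) (h1 : δ ≤ 1) {n : ℕ} (x : SourceString n)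
    (j : Fin n) : |meanTrace δ x j| ≤ 1 := by
  have hnn : ∀ S : Finset (Fin n), 0 ≤ retainProb δ S := fun S =>
    prod_nonneg fun i _ => by split_ifs <;> linarith
  calc |meanTrace δ x j| ≤ ∑ S : Finset (Fin n), |retainProb δ S * paddedEntry (traceOf x S) j| :=
        abs_sum_le_sum_abs _ _
    _ ≤ ∑ S : Finset (Fin n), retainProb δ S := sum_le_sum fun S _ => by
        rw [abs_mul, abs_of_nonneg (hnn S)]
        exact mul_le_of_le_one_right (hnn S) (abs_paddedEntry_le_one _ _)
    _ = 1 := sum_retainProb δ n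

/-- If one vector is an admissible estimate for two strings, each would have to be output from it
with probability at least `99 / 100`. -/
lemma MeanBasedAlgorithm.Reconstructs.inv_cost_lt_l1Dist {δ : ℝ} (h0 : 0 ≤ δ) (h1 : δ ≤ 1) {n : ℕ}
    {A : MeanBasedAlgorithm n} (hA : A.Reconstructs δ) {x x' : SourceString n} (hx : x ≠ x') :
    1 / (A.cost : ℝ) < l1Dist (meanTrace δ x) (meanTrace δ x') := by
  by_contra! hle
  have hIcc : ∀ j, meanTrace δ x j ∈ Set.Icc (-1 : ℝ) 1 := fun j =>
    abs_le.1 (abs_meanTrace_le_one h0 h1 x j)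
  have hp := hA x (meanTrace δ x) ⟨hIcc, by simp [l1Dist]⟩
  have hp' := hA x' (meanTrace δ x) ⟨hIcc, hle⟩
  have hsum : A.output (meanTrace δ x) x + A.output (meanTrace δ x) x' ≤ 1 := by
    rw [← (A.output (meanTrace δ x)).tsum_coe, ← sum_pair hx]
    exact ENNReal.sum_le_tsum _
  have hlt : (1 : ENNReal) < 99 / 100 + 99 / 100 := by
    rw [ENNReal.div_add_div_same, ENNReal.lt_div_iff_mul_lt (by simp) (by simp)]
    norm_num
  exact absurd ((add_le_add hp hp').trans hsum) hlt.not_ge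

/-! ### From the circle to the coefficients -/

/-- By Parseval's identity, each coefficient of a polynomial is at most its maximum on the unit
circle. -/
lemma norm_coeff_le_of_forall_norm_eval_le (p : Polynomial ℂ) {M : ℝ}
    (hM : ∀ w : ℂ, ‖w‖ = 1 → ‖p.eval w‖ ≤ M) (j : ℕ) : ‖p.coeff j‖ ≤ M := by
  have hM0 : 0 ≤ M := (norm_nonneg _).trans (hM 1 (by simp))
  by_cases hj : j ∈ p.support
  · refine le_of_sq_le_sq ?_ hM0
    calc ‖p.coeff j‖ ^ 2 ≤ ∑ i ∈ p.support, ‖p.coeff i‖ ^ 2 :=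
          single_le_sum (f := fun i => ‖p.coeff i‖ ^ 2) (fun _ _ => by positivity) hj
      _ = Real.circleAverage (fun θ => ‖p.eval θ‖ ^ 2) 0 1 :=
          p.sum_sq_norm_coeff_eq_circleAverage
      _ ≤ M ^ 2 := by
          refine Real.circleAverage_mono_on_of_le_circle ?_ fun w hw => ?_
          · exact ContinuousOn.circleIntegrable' (by fun_prop)
          · exact pow_le_pow_left₀ (norm_nonneg _) (hM w (by simpa using hw)) 2
  · rw [Polynomial.notMem_support_iff.1 hj, norm_zero]
    exact hM0

lemma l1Dist_meanTrace_le {δ : ℝ} (h0 : 0 ≤ δ) (h1 : δ ≤ 1) {n : ℕ} (x x' : SourceString n)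
    {M : ℝ} (hM : ∀ w : ℂ, ‖w‖ = 1 →
      ‖∑ i : Fin n, ((x i : ℤ) : ℂ) * (δ + (1 - δ) * w) ^ (i : ℕ) -
        ∑ i : Fin n, ((x' i : ℤ) : ℂ) * (δ + (1 - δ) * w) ^ (i : ℕ)‖ ≤ M) :
    l1Dist (meanTrace δ x) (meanTrace δ x') ≤ n * M := by
  set p : Polynomial ℂ := ∑ j : Fin n,
    Polynomial.monomial (j : ℕ) ((meanTrace δ x j - meanTrace δ x' j : ℝ) : ℂ)
  have hcoeff : ∀ j : Fin n, p.coeff j = ((meanTrace δ x j - meanTrace δ x' j : ℝ) : ℂ) := by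
    intro j
    simp [p, Polynomial.coeff_monomial, Fin.val_inj]
  have heval : ∀ w : ℂ, ‖w‖ = 1 → ‖p.eval w‖ ≤ M := by
    intro w hw
    have : p.eval w = (1 - δ) * (∑ i : Fin n, ((x i : ℤ) : ℂ) * (δ + (1 - δ) * w) ^ (i : ℕ) -
        ∑ i : Fin n, ((x' i : ℤ) : ℂ) * (δ + (1 - δ) * w) ^ (i : ℕ)) := by
      rw [mul_sub, ← sum_meanTrace_mul_pow, ← sum_meanTrace_mul_pow, ← sum_sub_distrib]
      simp [p, Polynomial.eval_finsetSum]
    rw [this, norm_mul]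
    have hδ : ‖(1 - δ : ℂ)‖ ≤ 1 := by
      rw [← Complex.ofReal_one, ← Complex.ofReal_sub, Complex.norm_real, Real.norm_eq_abs, abs_le]
      constructor <;> linarith
    exact (mul_le_of_le_one_left (norm_nonneg _) hδ).trans (hM w hw)
  calc l1Dist (meanTrace δ x) (meanTrace δ x')
      = ∑ j : Fin n, ‖p.coeff j‖ := by simp [l1Dist, hcoeff, -Complex.ofReal_sub]
    _ ≤ ∑ _j : Fin n, M :=
        sum_le_sum fun j _ => norm_coeff_le_of_forall_norm_eval_le p heval j
    _ = n * M := by simp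

/-- The circle with centre `δ` and radius `1 - δ` is tangent to the unit circle at `1`; away from
`1` its points lie quadratically far inside the unit disc. -/
lemma sq_norm_affine_circle {δ : ℝ} (h1 : δ < 1) {w : ℂ} (hw : ‖w‖ = 1) :
    ‖(δ + (1 - δ) * w : ℂ)‖ ^ 2 = 1 - δ / (1 - δ) * ‖(δ + (1 - δ) * w : ℂ) - 1‖ ^ 2 := by
  have hδ : 1 - δ ≠ 0 := by linarith
  have hw2 : w.re * w.re + w.im * w.im = 1 := by
    rw [← Complex.normSq_apply, Complex.normSq_eq_norm_sq, hw, one_pow]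
  rw [← Complex.normSq_eq_norm_sq, ← Complex.normSq_eq_norm_sq, Complex.normSq_apply,
    Complex.normSq_apply]
  simp only [Complex.add_re, Complex.ofReal_re, Complex.mul_re, Complex.sub_re, Complex.one_re,
    Complex.sub_im, Complex.one_im, Complex.ofReal_im, Complex.add_im, Complex.mul_im]
  field_simp
  linear_combination (1 - δ) ^ 2 * hw2

lemma norm_affine_circle_le_exp {δ a : ℝ} (h0 : 0 ≤ δ) (h1 : δ < 1) (ha : 0 ≤ a) {w : ℂ}
    (hw : ‖w‖ = 1) (haw : a ≤ ‖(δ + (1 - δ) * w : ℂ) - 1‖) :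
    ‖(δ + (1 - δ) * w : ℂ)‖ ≤ Real.exp (-(δ / (2 * (1 - δ)) * a ^ 2)) := by
  refine le_of_sq_le_sq ?_ (Real.exp_pos _).le
  have hδ : 0 ≤ δ / (1 - δ) := div_nonneg h0 (by linarith)
  have hsq := mul_le_mul_of_nonneg_left (pow_le_pow_left₀ ha haw 2) hδ
  rw [sq_norm_affine_circle h1 hw, ← Real.exp_nat_mul]
  refine le_trans ?_ (Real.add_one_le_exp _)
  have : ((2 : ℕ) : ℝ) * -(δ / (2 * (1 - δ)) * a ^ 2) = -(δ / (1 - δ) * a ^ 2) := by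
    have : 1 - δ ≠ 0 := by linarith
    push_cast
    field_simp
  linarith

/-! ### Two polynomials close to each other near `1` -/

/-- The remainder of the Taylor polynomial of `z ^ j` at `1`: the tail of the binomial expansion
at radius `a` is `4 ^ (-D)` times part of the expansion at radius `4 a`. -/
lemma norm_pow_sub_sum_choose_le {z : ℂ} {a : ℝ} (hz : ‖z - 1‖ ≤ a) (j D : ℕ) :
    ‖z ^ j - ∑ d ∈ range D, (j.choose d : ℂ) * (z - 1) ^ d‖ ≤ (1 + 4 * a) ^ j / 4 ^ D := by
  have ha : 0 ≤ a := (norm_nonneg _).trans hz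
  set N := D + (j + 1)
  have hexp : ∀ R : Type, ∀ _ : CommRing R, ∀ u : R,
      (1 + u) ^ j = ∑ d ∈ range N, (j.choose d : R) * u ^ d := by
    intro R _ u
    rw [add_comm, add_pow]
    simp only [one_pow, mul_one]
    rw [sum_congr rfl fun d _ => mul_comm (u ^ d) _]
    refine sum_subset (range_mono (by omega)) fun d _ hd => ?_
    rw [Nat.choose_eq_zero_of_lt (by simpa using hd)]
    simp
  have hz' : z ^ j = ∑ d ∈ range N, (j.choose d : ℂ) * (z - 1) ^ d := by
    rw [← hexp ℂ inferInstance (z - 1)]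
    ring
  rw [hz', ← sum_range_add_sum_Ico _ (show D ≤ N by omega), add_sub_cancel_left,
    le_div_iff₀ (by positivity), hexp ℝ inferInstance (4 * a)]
  calc ‖∑ d ∈ Ico D N, (j.choose d : ℂ) * (z - 1) ^ d‖ * 4 ^ D
      ≤ (∑ d ∈ Ico D N, (j.choose d : ℝ) * a ^ d) * 4 ^ D := by
        gcongr
        refine norm_sum_le_of_le _ fun d _ => ?_
        rw [norm_mul, norm_pow, Complex.norm_natCast]
        gcongr
    _ ≤ ∑ d ∈ Ico D N, (j.choose d : ℝ) * (4 * a) ^ d := by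
        rw [sum_mul]
        refine sum_le_sum fun d hd => ?_
        have : (4 : ℝ) ^ D ≤ 4 ^ d := pow_le_pow_right₀ (by norm_num) (mem_Ico.1 hd).1
        calc (j.choose d : ℝ) * a ^ d * 4 ^ D ≤ (j.choose d : ℝ) * a ^ d * 4 ^ d := by gcongr
          _ = _ := by rw [mul_pow]; ring
    _ ≤ _ := by
        refine sum_le_sum_of_subset_of_nonneg ?_ fun _ _ _ => by positivity
        intro d hd
        exact mem_range.2 (mem_Ico.1 hd).2

/-- At radius `b / (64 t)` the binomial expansions of degree at most `64 t ^ 2` have total mass at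
most `exp (b t)`, which bounds both the Taylor coefficients and the Taylor remainders. -/
lemma one_add_mul_pow_le {t b : ℕ} (ht : 1 ≤ t) :
    (1 + b * (1 / (64 * t)) : ℝ) ^ (64 * t ^ 2) ≤ (3 ^ t) ^ b := by
  have ht' : (0 : ℝ) < t := by exact_mod_cast ht
  calc (1 + b * (1 / (64 * t)) : ℝ) ^ (64 * t ^ 2)
      ≤ Real.exp (b * (1 / (64 * t))) ^ (64 * t ^ 2) := by
        gcongr
        rw [add_comm]
        exact Real.add_one_le_exp _
    _ = Real.exp 1 ^ (t * b) := by
        rw [← Real.exp_nat_mul, ← Real.exp_nat_mul]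
        congr 1
        push_cast
        field_simp
    _ ≤ 3 ^ (t * b) := by gcongr; exact Real.exp_one_lt_three.le
    _ = (3 ^ t) ^ b := pow_mul _ _ _

lemma sum_choose_mul_pow_le {t : ℕ} (ht : 1 ≤ t) {S : Finset ℕ} (hS : S ⊆ range (64 * t ^ 2))
    (d : ℕ) : ∑ j ∈ S, (j.choose d : ℝ) * (1 / (64 * t)) ^ d ≤ 64 * t ^ 2 * 3 ^ t := by
  set a : ℝ := 1 / (64 * t)
  have ha : 0 ≤ a := by positivity
  have hj : ∀ j ∈ S, (j.choose d : ℝ) * a ^ d ≤ 3 ^ t := by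
    intro j hj
    have hjm : j ≤ 64 * t ^ 2 := (mem_range.1 (hS hj)).le
    have h1 : (1 + a) ^ j ≤ 3 ^ t := by
      have := one_add_mul_pow_le (b := 1) ht
      simp only [Nat.cast_one, one_mul, pow_one] at this
      exact (pow_le_pow_right₀ (by linarith) hjm).trans this
    refine le_trans ?_ h1
    by_cases hdj : d ≤ j
    · rw [add_comm, add_pow]
      simp only [one_pow, mul_one]
      rw [mul_comm]
      exact single_le_sum (f := fun i => a ^ i * (j.choose i : ℝ)) (fun _ _ => by positivity)
        (mem_range.2 (by omega))
    · rw [Nat.choose_eq_zero_of_lt (by omega)]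
      simp only [Nat.cast_zero, zero_mul]
      positivity
  calc _ ≤ ∑ _j ∈ S, (3 : ℝ) ^ t := sum_le_sum hj
    _ = #S * 3 ^ t := by simp
    _ ≤ _ := by
      gcongr
      have := card_le_card hS
      rw [card_range] at this
      exact_mod_cast this

lemma mul_sq_mul_pow_lt {t : ℕ} (ht : 3 ≤ t) : 64 * t ^ 2 * 9 ^ t + 1 < 256 ^ t := by
  have h1 : 64 ≤ 4 ^ t := by
    calc 64 = 4 ^ 3 := by norm_num
      _ ≤ 4 ^ t := Nat.pow_le_pow_right (by norm_num) ht
  have h2 : t ^ 2 ≤ 4 ^ t := by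
    calc t ^ 2 ≤ (2 ^ t) ^ 2 := Nat.pow_le_pow_left Nat.lt_two_pow_self.le 2
      _ = 4 ^ t := by rw [← pow_mul, mul_comm, pow_mul]; norm_num
  have h3 : 64 * t ^ 2 * 9 ^ t ≤ 144 ^ t := by
    calc _ ≤ 4 ^ t * 4 ^ t * 9 ^ t := by gcongr
      _ = 144 ^ t := by rw [← mul_pow, ← mul_pow]; norm_num
  have h4 : 144 ^ t < 255 ^ t := Nat.pow_lt_pow_left (by norm_num) (by omega)
  have h5 : 255 ^ t < 256 ^ t := Nat.pow_lt_pow_left (by norm_num) (by omega)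
  omega

/-- By the pigeonhole principle, two polynomials with coefficients in `{0, 1}` have nearly equal
normalised Taylor coefficients at `1` of all orders below `8 t`. There are `2 ^ (64 t ^ 2)`
polynomials, and rounding `8 t` numbers in `[0, 64 t ^ 2 * 3 ^ t]` to multiples of `3 ^ (-t)` leaves
fewer than `(256 ^ t) ^ (8 t) = 2 ^ (64 t ^ 2)` possibilities. -/
lemma exists_ne_taylor_coeff_close {t : ℕ} (ht : 3 ≤ t) :
    ∃ S ⊆ range (64 * t ^ 2), ∃ S' ⊆ range (64 * t ^ 2), S ≠ S' ∧ ∀ d < 8 * t,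
      |∑ j ∈ S, (j.choose d : ℝ) * (1 / (64 * t)) ^ d -
        ∑ j ∈ S', (j.choose d : ℝ) * (1 / (64 * t)) ^ d| ≤ 1 / 3 ^ t := by
  set v : Finset ℕ → ℕ → ℝ := fun S d => ∑ j ∈ S, (j.choose d : ℝ) * (1 / (64 * t)) ^ d
  have hv0 : ∀ S d, 0 ≤ v S d := fun S d => sum_nonneg fun _ _ => by positivity
  set F : Finset ℕ → Fin (8 * t) → ℕ := fun S d => ⌊3 ^ t * v S d⌋₊
  set B : Finset (Fin (8 * t) → ℕ) :=
    Fintype.piFinset fun _ => range (64 * t ^ 2 * 9 ^ t + 1)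
  have hcard : #B < #(range (64 * t ^ 2)).powerset := by
    rw [Fintype.card_piFinset_const, card_range, card_powerset, card_range]
    calc _ < (256 ^ t) ^ (8 * t) := Nat.pow_lt_pow_left (mul_sq_mul_pow_lt ht) (by omega)
      _ = 2 ^ (64 * t ^ 2) := by
        rw [show 256 = 2 ^ 8 by norm_num, ← pow_mul, ← pow_mul]
        congr 1
        ring
  have hmaps : ∀ S ∈ (range (64 * t ^ 2)).powerset, F S ∈ B := by
    intro S hS
    refine Fintype.mem_piFinset.2 fun d => mem_range.2 (Nat.lt_succ_of_le (Nat.floor_le_of_le ?_))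
    have h := mul_le_mul_of_nonneg_left
      (sum_choose_mul_pow_le (by omega : 1 ≤ t) (mem_powerset.1 hS) d)
      (by positivity : (0 : ℝ) ≤ 3 ^ t)
    refine h.trans_eq ?_
    push_cast
    rw [show (9 : ℝ) = 3 * 3 by norm_num, mul_pow]
    ring
  obtain ⟨S, hS, S', hS', hne, heq⟩ := exists_ne_map_eq_of_card_lt_of_maps_to hcard hmaps
  refine ⟨S, mem_powerset.1 hS, S', mem_powerset.1 hS', hne, fun d hd => ?_⟩
  change |v S d - v S' d| ≤ 1 / 3 ^ t
  have hfl : ⌊3 ^ t * v S d⌋₊ = ⌊3 ^ t * v S' d⌋₊ := congrFun heq ⟨d, hd⟩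
  have hnn : ∀ S, 0 ≤ 3 ^ t * v S d := fun S => mul_nonneg (by positivity) (hv0 S d)
  have h1 := Nat.floor_le (hnn S)
  have h2 := Nat.lt_floor_add_one (3 ^ t * v S d)
  have h3 := Nat.floor_le (hnn S')
  have h4 := Nat.lt_floor_add_one (3 ^ t * v S' d)
  rw [hfl] at h1 h2
  have h5 : |(v S d - v S' d) * 3 ^ t| ≤ 1 := abs_le.2 ⟨by linarith, by linarith⟩
  rwa [abs_mul, abs_of_pos (by positivity : (0 : ℝ) < 3 ^ t),
    ← le_div_iff₀ (by positivity)] at h5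

/-- Two polynomials with coefficients in `{0, 1}` and degree below `64 t ^ 2` whose difference is
exponentially small in `t` throughout the disc of radius `1 / (64 t)` about `1`. -/
lemma exists_ne_sum_pow_close {t : ℕ} (ht : 3 ≤ t) :
    ∃ S ⊆ range (64 * t ^ 2), ∃ S' ⊆ range (64 * t ^ 2), S ≠ S' ∧
      ∀ z : ℂ, ‖z - 1‖ ≤ 1 / (64 * t) →
        ‖∑ j ∈ S, z ^ j - ∑ j ∈ S', z ^ j‖ ≤ 136 * t ^ 2 / 3 ^ t := by
  obtain ⟨S, hS, S', hS', hne, hclose⟩ := exists_ne_taylor_coeff_close ht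
  refine ⟨S, hS, S', hS', hne, fun z hz => ?_⟩
  have ht0 : (0 : ℝ) < t := by exact_mod_cast (by omega : 0 < t)
  set a : ℝ := 1 / (64 * t)
  have ha : 0 < a := by positivity
  have htail : ∀ S ⊆ range (64 * t ^ 2),
      ‖∑ j ∈ S, z ^ j - ∑ d ∈ range (8 * t), (∑ j ∈ S, (j.choose d : ℂ)) * (z - 1) ^ d‖ ≤
        64 * t ^ 2 / 3 ^ t := by
    intro S hS
    simp_rw [sum_mul]
    rw [sum_comm, ← sum_sub_distrib]
    have hj : ∀ j ∈ S, ‖z ^ j - ∑ d ∈ range (8 * t), (j.choose d : ℂ) * (z - 1) ^ d‖ ≤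
        1 / 3 ^ t := by
      intro j hj
      refine (norm_pow_sub_sum_choose_le hz j (8 * t)).trans ?_
      have h4 : (1 + 4 * a) ^ j ≤ (3 ^ t) ^ 4 := by
        have := one_add_mul_pow_le (t := t) (b := 4) (by omega)
        push_cast at this
        exact (pow_le_pow_right₀ (by linarith) (mem_range.1 (hS hj)).le).trans this
      rw [div_le_div_iff₀ (by positivity) (by positivity), one_mul]
      calc (1 + 4 * a) ^ j * 3 ^ t ≤ (3 ^ t) ^ 4 * 3 ^ t := by gcongr
        _ = 243 ^ t := by rw [← pow_succ, ← pow_mul, mul_comm, pow_mul]; norm_num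
        _ ≤ 65536 ^ t := by gcongr; norm_num
        _ = 4 ^ (8 * t) := by rw [pow_mul]; norm_num
    calc _ ≤ ∑ _j ∈ S, (1 / 3 ^ t : ℝ) := norm_sum_le_of_le _ hj
      _ = #S * (1 / 3 ^ t) := by simp
      _ ≤ ((64 * t ^ 2 : ℕ) : ℝ) * (1 / 3 ^ t) := by
        gcongr
        simpa using card_le_card hS
      _ = _ := by push_cast; ring
  have hhead : ‖∑ d ∈ range (8 * t), (∑ j ∈ S, (j.choose d : ℂ)) * (z - 1) ^ d -
      ∑ d ∈ range (8 * t), (∑ j ∈ S', (j.choose d : ℂ)) * (z - 1) ^ d‖ ≤ 8 * t / 3 ^ t := by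
    rw [← sum_sub_distrib]
    have hd : ∀ d ∈ range (8 * t), ‖(∑ j ∈ S, (j.choose d : ℂ)) * (z - 1) ^ d -
        (∑ j ∈ S', (j.choose d : ℂ)) * (z - 1) ^ d‖ ≤ 1 / 3 ^ t := by
      intro d hd
      refine le_trans ?_ (hclose d (mem_range.1 hd))
      rw [← sub_mul, norm_mul, norm_pow, ← sum_mul, ← sum_mul, ← sub_mul, abs_mul,
        abs_of_pos (pow_pos ha d)]
      have : (∑ j ∈ S, (j.choose d : ℂ)) - ∑ j ∈ S', (j.choose d : ℂ) =
          ((∑ j ∈ S, (j.choose d : ℝ) - ∑ j ∈ S', (j.choose d : ℝ) : ℝ) : ℂ) := by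
        push_cast; rfl
      rw [this, Complex.norm_real, Real.norm_eq_abs]
      gcongr
    calc _ ≤ ∑ _d ∈ range (8 * t), (1 / 3 ^ t : ℝ) := norm_sum_le_of_le _ hd
      _ = 8 * t / 3 ^ t := by simp; ring
  have hle : (64 * t ^ 2 / 3 ^ t + 8 * t / 3 ^ t + 64 * t ^ 2 / 3 ^ t : ℝ) ≤
      136 * t ^ 2 / 3 ^ t := by
    rw [← add_div, ← add_div]
    have : (1 : ℝ) ≤ t := by exact_mod_cast (by omega : 1 ≤ t)
    gcongr
    nlinarith
  refine le_trans ?_ hle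
  set P := ∑ d ∈ range (8 * t), (∑ j ∈ S, (j.choose d : ℂ)) * (z - 1) ^ d
  set P' := ∑ d ∈ range (8 * t), (∑ j ∈ S', (j.choose d : ℂ)) * (z - 1) ^ d
  have h1 := htail S hS
  have h2 := htail S' hS'
  rw [norm_sub_rev] at h2
  calc ‖∑ j ∈ S, z ^ j - ∑ j ∈ S', z ^ j‖
      = ‖(∑ j ∈ S, z ^ j - P) + (P - P') + (P' - ∑ j ∈ S', z ^ j)‖ := by congr 1; ring
    _ ≤ _ := norm_add₃_le.trans (by gcongr)

/-! ### Strings with close mean traces -/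

/-- The source string with `1` exactly at the positions `s + j`, `j ∈ S`, and `-1` elsewhere. -/
def shiftedIndicator (n s : ℕ) (S : Finset ℕ) : SourceString n := fun i =>
  if s ≤ (i : ℕ) ∧ (i : ℕ) - s ∈ S then 1 else -1

lemma shiftedIndicator_injOn (s m : ℕ) :
    Set.InjOn (shiftedIndicator (s + m) s) {S | S ⊆ range m} := by
  have key : ∀ S S' : Finset ℕ, S ⊆ range m →
      shiftedIndicator (s + m) s S = shiftedIndicator (s + m) s S' → S ⊆ S' := by
    intro S S' hS h j hj
    have hjm := mem_range.1 (hS hj)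
    by_contra hj'
    have := congrFun h ⟨s + j, by omega⟩
    simp [shiftedIndicator, hj, hj', Units.ext_iff] at this
  exact fun S hS S' hS' h => (key S S' hS h).antisymm (key S' S hS' h.symm)

lemma sum_shiftedIndicator_mul_pow {s m : ℕ} {S : Finset ℕ} (hS : S ⊆ range m) (z : ℂ) :
    ∑ i : Fin (s + m), ((shiftedIndicator (s + m) s S i : ℤ) : ℂ) * z ^ (i : ℕ) =
      2 * z ^ s * ∑ j ∈ S, z ^ j - ∑ i ∈ range (s + m), z ^ i := by
  have hx : ∀ i : Fin (s + m), ((shiftedIndicator (s + m) s S i : ℤ) : ℂ) * z ^ (i : ℕ) =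
      2 * (if s ≤ (i : ℕ) ∧ (i : ℕ) - s ∈ S then z ^ (i : ℕ) else 0) - z ^ (i : ℕ) := by
    intro i
    unfold shiftedIndicator
    split_ifs <;> simp
    ring
  rw [sum_congr rfl fun i _ => hx i, sum_sub_distrib, ← mul_sum,
    Fin.sum_univ_eq_sum_range (fun i => if s ≤ i ∧ i - s ∈ S then z ^ i else 0) (s + m),
    Fin.sum_univ_eq_sum_range (fun i => z ^ i) (s + m), sum_range_add, mul_assoc]
  have h0 : ∑ i ∈ range s, (if s ≤ i ∧ i - s ∈ S then z ^ i else 0) = 0 :=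
    sum_eq_zero fun i hi => if_neg fun h => (mem_range.1 hi).not_ge h.1
  rw [h0, zero_add]
  simp only [Nat.le_add_right, Nat.add_sub_cancel_left, true_and]
  rw [sum_ite_mem, inter_eq_right.2 hS]
  simp_rw [pow_add, mul_sum]

/-- A rate `γ` such that some two strings of length `n ≥ t ^ 3` have mean traces within
`exp (-γ t)`, up to a polynomial factor. The bound `1` comes from the arc of the circle near `1`,
the other one from the rest of the circle: `δ / (2 (1 - δ)) * (1 / (64 t)) ^ 2 * (t ^ 3 / 2)` is
`δ / (16384 (1 - δ)) * t`. -/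
noncomputable def closenessRate (δ : ℝ) : ℝ := min 1 (δ / (16384 * (1 - δ)))

lemma closenessRate_pos {δ : ℝ} (h0 : 0 < δ) (h1 : δ < 1) : 0 < closenessRate δ :=
  lt_min one_pos (div_pos h0 (by linarith))

/-- On the arc of the circle near `1` the two polynomials are close by the choice of `S` and `S'`;
on the rest of it, the factor `z ^ s` is small. -/
lemma exists_ne_l1Dist_meanTrace_le {δ : ℝ} (h0 : 0 < δ) (h1 : δ < 1) {t n : ℕ} (ht : 128 ≤ t)
    (hn : t ^ 3 ≤ n) :
    ∃ x x' : SourceString n, x ≠ x' ∧ l1Dist (meanTrace δ x) (meanTrace δ x') ≤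
      n * (272 * t ^ 2 * Real.exp (-(closenessRate δ * t))) := by
  obtain ⟨S, hS, S', hS', hne, hclose⟩ := exists_ne_sum_pow_close (by omega : 3 ≤ t)
  set m := 64 * t ^ 2
  -- The bound `128 ≤ t` leaves a shift `s` of at least `t ^ 3 / 2`.
  have hm : 2 * m ≤ t ^ 3 := by
    calc 2 * m = 128 * t ^ 2 := by simp only [m]; ring
      _ ≤ t * t ^ 2 := by gcongr
      _ = t ^ 3 := by ring
  obtain ⟨s, rfl⟩ : ∃ s, n = s + m := ⟨n - m, by omega⟩
  have hs : (t : ℝ) ^ 3 ≤ 2 * s := by exact_mod_cast (by omega : t ^ 3 ≤ 2 * s)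
  have ht0 : (0 : ℝ) < t := by exact_mod_cast (by omega : 0 < t)
  have hδ : 0 < 1 - δ := by linarith
  refine ⟨shiftedIndicator _ s S, shiftedIndicator _ s S',
    fun h => hne (shiftedIndicator_injOn s m hS hS' h),
    l1Dist_meanTrace_le h0.le h1.le _ _ fun w hw => ?_⟩
  set z : ℂ := δ + (1 - δ) * w
  rw [sum_shiftedIndicator_mul_pow hS, sum_shiftedIndicator_mul_pow hS', sub_sub_sub_cancel_right,
    ← mul_sub, norm_mul, norm_mul, norm_pow, Complex.norm_ofNat]
  have hexp1 : (1 / 3 ^ t : ℝ) ≤ Real.exp (-(closenessRate δ * t)) := by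
    rw [Real.exp_neg, ← one_div]
    gcongr
    calc Real.exp (closenessRate δ * t) ≤ Real.exp (t * 1) := by
          rw [mul_comm]
          gcongr
          exact min_le_left _ _
      _ ≤ 3 ^ t := by
        rw [Real.exp_nat_mul]
        gcongr
        exact Real.exp_one_lt_three.le
  have hz1 : ‖z‖ ≤ 1 := by
    simpa using norm_affine_circle_le_exp h0.le h1 le_rfl hw (norm_nonneg _)
  rcases le_total ‖z - 1‖ (1 / (64 * t)) with hz | hz
  · calc 2 * ‖z‖ ^ s * ‖∑ j ∈ S, z ^ j - ∑ j ∈ S', z ^ j‖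
        ≤ 2 * 1 * (136 * t ^ 2 / 3 ^ t) := by
          gcongr
          · exact pow_le_one₀ (norm_nonneg _) hz1
          · exact hclose z hz
      _ = 272 * t ^ 2 * (1 / 3 ^ t) := by ring
      _ ≤ _ := by gcongr
  · have hsum : ∀ S ⊆ range m, ‖∑ j ∈ S, z ^ j‖ ≤ 64 * t ^ 2 := by
      intro S hS
      calc ‖∑ j ∈ S, z ^ j‖ ≤ ∑ _j ∈ S, (1 : ℝ) := norm_sum_le_of_le _ fun j _ => by
            rw [norm_pow]
            exact pow_le_one₀ (norm_nonneg _) hz1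
        _ = #S := by simp
        _ ≤ (m : ℕ) := by
          have := card_le_card hS
          rw [card_range] at this
          exact_mod_cast this
        _ = _ := by simp [m]
    have hzs : ‖z‖ ^ s ≤ Real.exp (-(closenessRate δ * t)) := by
      calc ‖z‖ ^ s ≤ Real.exp (-(δ / (2 * (1 - δ)) * (1 / (64 * t)) ^ 2)) ^ s := by
            gcongr
            exact norm_affine_circle_le_exp h0.le h1 (by positivity) hw hz
        _ ≤ Real.exp (-(closenessRate δ * t)) := by
            rw [← Real.exp_nat_mul, Real.exp_le_exp]
            have hmin : closenessRate δ * t ≤ δ / (16384 * (1 - δ)) * t := by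
              gcongr
              exact min_le_right _ _
            have hst : δ / (16384 * (1 - δ)) * t ≤
                s * (δ / (2 * (1 - δ)) * (1 / (64 * t)) ^ 2) := by
              calc δ / (16384 * (1 - δ)) * t
                  = (t ^ 3 / 2) * (δ / (2 * (1 - δ)) * (1 / (64 * t)) ^ 2) := by
                    field_simp
                    norm_num
                _ ≤ _ := by
                    gcongr
                    linarith
            linarith
    calc 2 * ‖z‖ ^ s * ‖∑ j ∈ S, z ^ j - ∑ j ∈ S', z ^ j‖
        ≤ 2 * Real.exp (-(closenessRate δ * t)) * (64 * t ^ 2 + 64 * t ^ 2) := by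
          gcongr
          exact (norm_sub_le _ _).trans (add_le_add (hsum S hS) (hsum S' hS'))
      _ = 256 * t ^ 2 * Real.exp (-(closenessRate δ * t)) := by ring
      _ ≤ _ := by gcongr; norm_num

lemma exists_rate_l1Dist_meanTrace_le {δ : ℝ} (h0 : 0 < δ) (h1 : δ < 1) :
    ∃ c : ℝ, 0 < c ∧ ∃ n₀ : ℕ, ∀ n : ℕ, n₀ ≤ n → ∃ x x' : SourceString n, x ≠ x' ∧
      l1Dist (meanTrace δ x) (meanTrace δ x') ≤ Real.exp (-(c * (n : ℝ) ^ ((1 : ℝ) / 3))) := by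
  set γ := closenessRate δ
  have hγ : 0 < γ := closenessRate_pos h0 h1
  have hfloor : Filter.Tendsto (fun n : ℕ => ⌊(n : ℝ) ^ ((1 : ℝ) / 3)⌋₊)
      Filter.atTop Filter.atTop :=
    tendsto_nat_floor_atTop.comp
      ((tendsto_rpow_atTop (by norm_num)).comp tendsto_natCast_atTop_atTop)
  have hpoly : ∀ᶠ t : ℕ in Filter.atTop, (t : ℝ) ^ 5 ≤ 1 / 2176 * Real.exp (γ / 2 * t) := by
    have h := ((isLittleO_pow_exp_pos_mul_atTop 5 (half_pos hγ)).comp_tendsto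
      (tendsto_natCast_atTop_atTop (R := ℝ))).bound (by norm_num : (0 : ℝ) < 1 / 2176)
    filter_upwards [h] with t ht
    simpa using ht
  obtain ⟨n₀, hn₀⟩ := Filter.eventually_atTop.1
    (hfloor.eventually (hpoly.and (Filter.eventually_ge_atTop 128)))
  refine ⟨γ / 4, by positivity, n₀, fun n hn => ?_⟩
  obtain ⟨hpow, ht⟩ := hn₀ n hn
  set r : ℝ := (n : ℝ) ^ ((1 : ℝ) / 3)
  set t : ℕ := ⌊r⌋₊
  have hr0 : 0 ≤ r := by positivity
  have hr3 : r ^ 3 = n := by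
    rw [← Real.rpow_natCast, ← Real.rpow_mul (by positivity)]
    norm_num
  have htr : (t : ℝ) ≤ r := Nat.floor_le hr0
  have hrt : r ≤ 2 * t := by
    have h1 := (Nat.lt_floor_add_one r).le
    have h2 : (1 : ℝ) ≤ t := by exact_mod_cast (by omega : 1 ≤ t)
    change r ≤ (t : ℝ) + 1 at h1
    linarith
  have htn : t ^ 3 ≤ n := by
    have : (t : ℝ) ^ 3 ≤ n := hr3 ▸ pow_le_pow_left₀ (by positivity) htr 3
    exact_mod_cast this
  obtain ⟨x, x', hne, hdist⟩ := exists_ne_l1Dist_meanTrace_le h0 h1 ht htn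
  refine ⟨x, x', hne, hdist.trans ?_⟩
  calc (n : ℝ) * (272 * t ^ 2 * Real.exp (-(γ * t)))
      ≤ (2 * t) ^ 3 * (272 * t ^ 2 * Real.exp (-(γ * t))) := by
        rw [← hr3]
        gcongr
    _ = 2176 * t ^ 5 * Real.exp (-(γ * t)) := by ring
    _ ≤ 2176 * (1 / 2176 * Real.exp (γ / 2 * t)) * Real.exp (-(γ * t)) := by gcongr
    _ = Real.exp (-(γ / 2 * t)) := by
        rw [← mul_assoc, mul_one_div_cancel (by norm_num), one_mul, ← Real.exp_add]
        congr 1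
        ring
    _ ≤ Real.exp (-(γ / 4 * r)) := by
        rw [Real.exp_le_exp]
        nlinarith

end TraceReconstruction

theorem theorem2 (δ : ℝ) (hδ0 : 0 < δ) (hδ1 : δ < 1) :
    ∃ c : ℝ, 0 < c ∧ ∃ n₀ : ℕ, ∀ n : ℕ, n₀ ≤ n →
      (∀ A : TraceReconstruction.MeanBasedAlgorithm n, A.Reconstructs δ →
        Real.exp (c * (n : ℝ) ^ ((1 : ℝ) / 3)) ≤ (A.cost : ℝ)) ∧
      (∃ x x' : TraceReconstruction.SourceString n, x ≠ x' ∧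
        TraceReconstruction.l1Dist (TraceReconstruction.meanTrace δ x)
            (TraceReconstruction.meanTrace δ x') ≤
          Real.exp (-(c * (n : ℝ) ^ ((1 : ℝ) / 3)))) := by
  obtain ⟨c, hc, n₀, h⟩ :=
    TraceReconstruction.exists_rate_l1Dist_meanTrace_le hδ0 hδ1
  refine ⟨c, hc, n₀, fun n hn => ⟨fun A hA => ?_, h n hn⟩⟩
  obtain ⟨x, x', hne, hdist⟩ := h n hn
  have hlt := (hA.inv_cost_lt_l1Dist hδ0.le hδ1.le hne).trans_le hdist
  have hcost : (0 : ℝ) < A.cost := by exact_mod_cast A.cost_pos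
  rw [Real.exp_neg, ← one_div, one_div_lt_one_div hcost (Real.exp_pos _)] at hlt
  exact hlt.le
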